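/- Let $\nu$ be a Borel measure on $(0,\infty)$ with $\int_0^\infty (1\wedge x)\,\nu(dx)<\infty$ and $0<\mu:=\int_0^\infty x\,\nu(dx)<\infty$. Let $\{\tilde X_t,\ t\ge 0\}$, $\tilde X_0=0$, be a Lévy subordinator (independent and stationary increments, nondecreasing right-continuous paths) with drift zero and Lévy measure $\nu$, that is, $E(e^{-u\tilde X_t})=\exp\bigl(-t\int_0^\infty(1-e^{-ux})\,\nu(dx)\bigr)$ for $u,t\ge 0$. Let $X_0>0$ be a random variable independent of $\{\tilde X_t\}$ with distribution function $$P(X_0\le x)=\frac1\mu\int_0^x \nu(y,\infty)\,dy,\qquad x\ge 0,$$ and put $X_t=X_0+\tilde X_t$ for $t\ge 0$. For $x\ge 0$ let $T_x=\inf\{t\ge 0: X_t>x\}$ and $\Gamma_x=X_{T_x}-x$. Then almost surely $T_x<\infty$ for all $x\ge 0$; for every $x\ge 0$ the overshoot $\Gamma_x$ has the same distribution as $X_0$; and the process $\{T_x,\ x\ge 0\}$ has stationary increments, that is, for every $h\ge 0$ the processes $\{T_{h+x}-T_h,\ x\ge 0\}$ and $\{T_x-T_0,\ x\ge 0\}$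 have the same finite-dimensional distributions. -/

import Mathlib

open MeasureTheory ProbabilityTheory Set
open scoped NNReal ENNReal

/-- `ν` is the Lévy measure of a subordinator: it is carried by `(0, ∞)` (in particular it has no
atom at zero) and `∫ (1 ∧ x) ν(dx) < ∞`. -/
structure IsSubordinatorLevyMeasure (ν : Measure ℝ) : Prop where
  carried_by_pos : ν (Iic 0) = 0
  lintegral_min_lt_top : ∫⁻ x, ENNReal.ofReal (min 1 x) ∂ν < ∞

/-- The first moment `μ = ∫ x ν(dx) ∈ [0, ∞]` of a measure carried by `(0, ∞)`. -/
noncomputable def levyMean (ν : Measure ℝ) : ℝ≥0∞ := ∫⁻ x, ENNReal.ofReal x ∂ν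

/-- The Laplace exponent `Φ(u) = ∫ (1 - e^{-ux}) ν(dx)` (no drift term). -/
noncomputable def laplaceExponent (ν : Measure ℝ) (u : ℝ) : ℝ :=
  ∫ x, (1 - Real.exp (-(u * x))) ∂ν

/-- `X` is a Lévy subordinator, started at `0`, with drift zero and Lévy measure `ν`: independent
and stationary increments, nondecreasing right-continuous paths (almost surely), and Laplace
exponent `Φ(u) = ∫ (1 - e^{-ux}) ν(dx)`, which says that the drift is zero and the Lévy measure
is `ν`. -/
structure IsDriftlessSubordinator {Ω : Type*} [MeasurableSpace Ω]
    (X : ℝ≥0 → Ω → ℝ) (ν : Measure ℝ) (P : Measure Ω) : Prop where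
  measurable : ∀ t, Measurable (X t)
  start_zero : ∀ᵐ ω ∂P, X 0 ω = 0
  indep_increments : HasIndepIncrements X P
  stationary_increments : ∀ s t : ℝ≥0, IdentDistrib (fun ω => X (s + t) ω - X s ω) (X t) P P
  monotone_paths : ∀ᵐ ω ∂P, Monotone fun t => X t ω
  rightContinuous_paths : ∀ᵐ ω ∂P, ∀ t : ℝ≥0, ContinuousWithinAt (fun s => X s ω) (Ici t) t
  laplace : ∀ (t : ℝ≥0) (u : ℝ), 0 ≤ u →
    ∫ ω, Real.exp (-(u * X t ω)) ∂P = Real.exp (-(t * laplaceExponent ν u))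

/-- The random variable `X₀` is positive (almost surely) with the integrated-tail distribution
function `P(X₀ ≤ x) = (1/μ) ∫_0^x ν(y, ∞) dy`, `x ≥ 0`. -/
def HasIntegratedTailLaw {Ω : Type*} [MeasurableSpace Ω]
    (X₀ : Ω → ℝ) (ν : Measure ℝ) (P : Measure Ω) : Prop :=
  ∀ x : ℝ, 0 ≤ x → P {ω | X₀ ω ≤ x} = (levyMean ν)⁻¹ * ∫⁻ y in Ioc 0 x, ν (Ioi y)

/-- The first passage time `T_x = inf {t ≥ 0 : X_t > x}`. The infimum of the empty set
is `0` in `ℝ≥0`, so this is meaningful only where the level `x` is exceeded at some time. -/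
noncomputable def firstPassage {Ω : Type*} (X : ℝ≥0 → Ω → ℝ) (x : ℝ≥0) (ω : Ω) : ℝ≥0 :=
  sInf {t : ℝ≥0 | (x : ℝ) < X t ω}

/-- The overshoot `Γ_x = X_{T_x} - x`. -/
noncomputable def overshoot {Ω : Type*} (X : ℝ≥0 → Ω → ℝ) (x : ℝ≥0) (ω : Ω) : ℝ :=
  X (firstPassage X x ω) ω - x

/-- The process `Y` has stationary increments: for every `h ≥ 0` the processes
`(Y_{h+x} - Y_h)_{x ≥ 0}` and `(Y_x - Y_0)_{x ≥ 0}` have the same finite-dimensional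
distributions. -/
def HasStationaryIncrements {Ω : Type*} [MeasurableSpace Ω]
    (Y : ℝ≥0 → Ω → ℝ) (P : Measure Ω) : Prop :=
  ∀ (h : ℝ≥0) (n : ℕ) (x : Fin n → ℝ≥0),
    IdentDistrib (fun ω (i : Fin n) => Y (h + x i) ω - Y h ω)
      (fun ω (i : Fin n) => Y (x i) ω - Y 0 ω) P P

/-! The overshoot law comes from computing one occupation measure twice. Let Φ be the Laplace
exponent. Fubini gives E e^{-uX₀} = Φ(u)/(μu). Since E e^{-uX̃_t} = e^{-tΦ(u)}, the expected
occupation measure of X has transform E e^{-uX₀}/Φ(u) = 1/(μu), so it is Lebesgue measure on (0,∞)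
divided by μ (`occupation_eq`).

Paths are monotone, so up to a single instant the time spent in (a,∞) is the time after T_a. By the
strong Markov property (`strong_markov`) the occupation measure restricted to (a,∞) has transform E
e^{-uX_{T_a}}/Φ(u); from the Lebesgue form it is e^{-ua}/(μu). Hence Γ_a has the transform of X₀,
and uniqueness (`ext_of_laplace_eq`) gives equality of laws (`map_overshoot`).

For the increments, T_{a+x} - T_a is the passage time over x of the path started at Γ_a and driven
by the increments after T_a. Those increments are independent of Γ_a and distributed as X̃, so this
path has the law of X, while T_0 = 0 because X₀ > 0 (`identDistrib_firstPassage_add_sub`).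

All this is done for a version with every path regular (`exists_regular`), and transferred back
along an almost sure equality. -/

open Filter Topology TopologicalSpace

/-! ### Uniqueness theorems for moments and Laplace transforms. -/

/-- A finite measure carried by `[0, 1]` is determined by its moments. -/
theorem ext_of_lintegral_pow_eq {μ ν : Measure ℝ} [IsFiniteMeasure μ] [IsFiniteMeasure ν]
    (hμ : ∀ᵐ x ∂μ, x ∈ Icc (0 : ℝ) 1) (hν : ∀ᵐ x ∂ν, x ∈ Icc (0 : ℝ) 1)
    (h : ∀ n : ℕ, ∫⁻ x, ENNReal.ofReal (x ^ n) ∂μ = ∫⁻ x, ENNReal.ofReal (x ^ n) ∂ν) :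
    μ = ν := by
  have integrable_of_cont : ∀ (ρ : Measure ℝ) [IsFiniteMeasure ρ],
      (∀ᵐ x ∂ρ, x ∈ Icc (0 : ℝ) 1) → ∀ f : ℝ → ℝ, Continuous f → Integrable f ρ := by
    intro ρ _ hρ f hf
    obtain ⟨C, hC⟩ := isCompact_Icc.exists_bound_of_continuousOn (f := f) (s := Icc (0 : ℝ) 1)
      hf.continuousOn
    exact Integrable.of_bound hf.aestronglyMeasurable C (hρ.mono fun x hx => hC x hx)
  have integral_pow : ∀ (ρ : Measure ℝ) [IsFiniteMeasure ρ],
      (∀ᵐ x ∂ρ, x ∈ Icc (0 : ℝ) 1) → ∀ n : ℕ,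
      ∫ x, x ^ n ∂ρ = (∫⁻ x, ENNReal.ofReal (x ^ n) ∂ρ).toReal := by
    intro ρ _ hρ n
    exact integral_eq_lintegral_of_nonneg_ae (hρ.mono fun x hx => pow_nonneg hx.1 n)
      (by fun_prop)
  have integral_poly : ∀ p : Polynomial ℝ, ∫ x, p.eval x ∂μ = ∫ x, p.eval x ∂ν := by
    intro p
    simp_rw [Polynomial.eval_eq_sum_range]
    rw [integral_finsetSum _ fun i _ => integrable_of_cont μ hμ _ (by fun_prop),
      integral_finsetSum _ fun i _ => integrable_of_cont ν hν _ (by fun_prop)]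
    refine Finset.sum_congr rfl fun i _ => ?_
    rw [integral_const_mul, integral_const_mul, integral_pow μ hμ, integral_pow ν hν, h]
  have close : ∀ (ρ : Measure ℝ) [IsFiniteMeasure ρ], (∀ᵐ x ∂ρ, x ∈ Icc (0 : ℝ) 1) →
      ∀ (f g : ℝ → ℝ), Continuous f → Continuous g → ∀ ε : ℝ,
      (∀ x ∈ Icc (0 : ℝ) 1, |f x - g x| < ε) →
      |∫ x, f x ∂ρ - ∫ x, g x ∂ρ| ≤ ε * ρ.real univ := by
    intro ρ _ hρ f g hf hg ε hfg
    rw [← integral_sub (integrable_of_cont ρ hρ f hf) (integrable_of_cont ρ hρ g hg)]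
    have := norm_integral_le_of_norm_le_const (f := fun x => f x - g x)
      (hρ.mono fun x hx => (Real.norm_eq_abs _).trans_le (hfg x hx).le)
    rwa [Real.norm_eq_abs] at this
  refine ext_of_forall_integral_eq_of_IsFiniteMeasure fun f => ?_
  refine eq_of_abs_sub_nonpos (le_of_forall_pos_le_add fun δ hδ => ?_)
  -- The approximation errors under the two measures add up to at most δ; the summand 1 keeps M
  -- positive when both measures vanish.
  set M := μ.real univ + ν.real univ + 1
  have hM : 0 < M := by positivity
  obtain ⟨p, hp⟩ := exists_polynomial_near_of_continuousOn 0 1 f f.continuous.continuousOn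
    (δ / M) (by positivity)
  have h1 := close μ hμ (fun x => p.eval x) f (by fun_prop) f.continuous _ hp
  have h2 := close ν hν (fun x => p.eval x) f (by fun_prop) f.continuous _ hp
  rw [integral_poly p] at h1
  have h3 : δ / M * μ.real univ + δ / M * ν.real univ ≤ δ := by
    rw [← mul_add, div_mul_eq_mul_div, div_le_iff₀ hM]
    exact mul_le_mul_of_nonneg_left (by simp [M]) hδ.le
  rw [abs_le] at h1 h2 ⊢
  constructor <;> linarith [h1.1, h1.2, h2.1, h2.2]

/-- A measure carried by `[0, ∞)` is determined by its Laplace transform on `(0, ∞)`, if that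
is finite. -/
theorem ext_of_laplace_eq {μ ν : Measure ℝ} (hμ : ∀ᵐ x ∂μ, 0 ≤ x) (hν : ∀ᵐ x ∂ν, 0 ≤ x)
    (hfin : ∫⁻ x, ENNReal.ofReal (Real.exp (-x)) ∂μ ≠ ∞)
    (h : ∀ u : ℝ, 0 < u → ∫⁻ x, ENNReal.ofReal (Real.exp (-(u * x))) ∂μ
      = ∫⁻ x, ENNReal.ofReal (Real.exp (-(u * x))) ∂ν) :
    μ = ν := by
  -- Tilting by e^{-x} makes the measures finite, and y = e^{-x} carries [0,∞) into [0,1]. Both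
  -- operations are invertible, and the n-th moment of the image is the Laplace transform at n + 1.
  let e : ℝ → ℝ≥0∞ := fun x => ENNReal.ofReal (Real.exp (-x))
  have he : Measurable e := by fun_prop
  let φ : ℝ → ℝ := fun x => Real.exp (-x)
  have hφ : Measurable φ := by fun_prop
  have untilt : ∀ ρ : Measure ℝ, (((ρ.withDensity e).map φ).map fun x => -Real.log x).withDensity
      (fun x => (e x)⁻¹) = ρ := by
    intro ρ
    rw [Measure.map_map (by fun_prop) hφ]
    have : (fun x => -Real.log x) ∘ φ = id := by
      ext x; simp [φ]
    rw [this, Measure.map_id]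
    exact withDensity_inv_same he (ae_of_all _ fun x => by simp [e, Real.exp_pos])
      (ae_of_all _ fun x => by simp [e])
  have supp : ∀ ρ : Measure ℝ, (∀ᵐ x ∂ρ, 0 ≤ x) →
      ∀ᵐ x ∂(ρ.withDensity e).map φ, x ∈ Icc (0 : ℝ) 1 := by
    intro ρ hρ
    refine (ae_map_iff hφ.aemeasurable measurableSet_Icc).2 ?_
    refine (withDensity_absolutelyContinuous ρ e).ae_le (hρ.mono fun x hx => ?_)
    exact ⟨(Real.exp_pos _).le, Real.exp_le_one_iff.2 (by linarith)⟩
  have moments : ∀ (ρ : Measure ℝ) (n : ℕ),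
      ∫⁻ x, ENNReal.ofReal (x ^ n) ∂(ρ.withDensity e).map φ
        = ∫⁻ x, ENNReal.ofReal (Real.exp (-((n + 1 : ℝ) * x))) ∂ρ := by
    intro ρ n
    rw [lintegral_map (by fun_prop) hφ, lintegral_withDensity_eq_lintegral_mul _ he (by fun_prop)]
    refine lintegral_congr fun x => ?_
    simp only [Pi.mul_apply, e, φ]
    rw [← ENNReal.ofReal_mul (Real.exp_pos _).le, ← Real.exp_nat_mul, ← Real.exp_add]
    congr 2
    ring
  have hmom : ∀ n : ℕ, ∫⁻ x, ENNReal.ofReal (x ^ n) ∂(μ.withDensity e).map φ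
      = ∫⁻ x, ENNReal.ofReal (x ^ n) ∂(ν.withDensity e).map φ := fun n => by
    rw [moments, moments, h _ (by positivity)]
  have fin : ∀ ρ : Measure ℝ, ∫⁻ x, ENNReal.ofReal (Real.exp (-x)) ∂ρ ≠ ∞ →
      IsFiniteMeasure ((ρ.withDensity e).map φ) := by
    intro ρ hρ
    have := isFiniteMeasure_withDensity hρ
    infer_instance
  have := fin μ hfin
  have hfin' := h 1 one_pos
  simp only [one_mul] at hfin'
  have := fin ν (hfin' ▸ hfin)
  rw [← untilt μ, ← untilt ν, ext_of_lintegral_pow_eq (supp μ hμ) (supp ν hν) hmom]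

/-! ### Processes with independent increments: laws, past and future. -/

/-- Independence of increments is applied along monotone sequences of times, so a finite set of
times has to be placed on one. The start at 0 lets telescoping sums recover the values of the
process, and N leaves finitely many increments to consider. -/
theorem exists_monotone_seq_covering (K : Finset ℝ≥0) :
    ∃ (t : ℕ → ℝ≥0) (N : ℕ), Monotone t ∧ t 0 = 0 ∧ ∀ k ∈ K, ∃ n ≤ N, t n = k := by
  induction K using Finset.induction_on_max with
  | empty => exact ⟨fun _ => 0, 0, monotone_const, rfl, by simp⟩
  | insert a s ha ih =>
    obtain ⟨t, N, ht, ht0, hcov⟩ := ih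
    refine ⟨fun n => if n ≤ N then min (t n) a else a, N + 1, ?_, by simp [ht0], ?_⟩
    · intro m n hmn
      dsimp only
      split_ifs with h1 h2
      · exact min_le_min_right a (ht hmn)
      · exact min_le_right _ _
      · omega
      · exact le_rfl
    · intro k hk
      rcases Finset.mem_insert.1 hk with rfl | hk
      · exact ⟨N + 1, le_rfl, by simp⟩
      · obtain ⟨n, hn, hnk⟩ := hcov k hk
        exact ⟨n, by omega, by simp [hn, hnk, (ha k hk).le]⟩

section
variable {Ω : Type*} [MeasurableSpace Ω] {P : Measure Ω} [IsProbabilityMeasure P]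
  {Y Z : ℝ≥0 → Ω → ℝ}

/-- Two processes with independent increments starting at zero have the same law as soon as their
increments have the same laws. -/
theorem identDistrib_process_of_indepIncrements (hYm : ∀ t, Measurable (Y t))
    (hZm : ∀ t, Measurable (Z t)) (hY0 : ∀ ω, Y 0 ω = 0) (hZ0 : ∀ ω, Z 0 ω = 0)
    (hY : HasIndepIncrements Y P) (hZ : HasIndepIncrements Z P)
    (h : ∀ s t, s ≤ t →
      IdentDistrib (fun ω => Y t ω - Y s ω) (fun ω => Z t ω - Z s ω) P P) :
    IdentDistrib (fun ω t => Y t ω) (fun ω t => Z t ω) P P := by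
  refine (identDistrib_iff_forall_finset_identDistrib
    (measurable_pi_lambda _ hYm).aemeasurable (measurable_pi_lambda _ hZm).aemeasurable).2
    fun I => ?_
  obtain ⟨t, N, ht, ht0, hcov⟩ := exists_monotone_seq_covering I
  choose! k _ hk using hcov
  -- Along the sequence the increments are independent, so equality of their individual laws gives
  -- equality of the joint laws; values are then partial sums.
  have key := IdentDistrib.pi (fun i => h (t i) (t (i + 1)) (ht i.le_succ)) (hY.nat ht) (hZ.nat ht)
  have hF : Measurable fun (y : ℕ → ℝ) (i : I) => ∑ j ∈ Finset.range (k i), y j := by fun_prop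
  have rep : ∀ W : ℝ≥0 → Ω → ℝ, (∀ ω, W 0 ω = 0) → (fun ω => I.restrict fun s => W s ω)
      = (fun (y : ℕ → ℝ) (i : I) => ∑ j ∈ Finset.range (k i), y j)
        ∘ fun ω j => W (t (j + 1)) ω - W (t j) ω := by
    intro W hW
    ext ω i
    simp [Finset.sum_range_sub (fun j => W (t j) ω), hk i i.2, ht0, hW]
  rw [rep Y hY0, rep Z hZ0]
  exact key.comp hF

/-- The past of a process with independent increments is independent of its future increments. -/
theorem indepFun_past_future (hYm : ∀ t, Measurable (Y t)) (hY0 : ∀ ω, Y 0 ω = 0)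
    (hY : HasIndepIncrements Y P) (s : ℝ≥0) :
    IndepFun (fun ω (r : Iic s) => Y r ω) (fun ω t => Y (s + t) ω - Y s ω) P := by
  classical
  refine IndepFun.process_indepFun_process (X := fun (r : Iic s) ω => Y r ω)
    (Y := fun t ω => Y (s + t) ω - Y s ω) (fun r => hYm r)
    (fun t => (hYm _).sub (hYm _)) fun I J => ?_
  obtain ⟨t, N, ht, ht0, hcov⟩ := exists_monotone_seq_covering
    (insert s (I.image Subtype.val ∪ J.image fun u => s + u))
  obtain ⟨m, hmN, hm⟩ := hcov s (by simp)
  -- The sequence may repeat values, so an index beyond m can still represent a time at most s; that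
  -- time is then s itself, and m serves.
  have hI : ∀ r : I, ∃ k ≤ m, t k = r := by
    intro r
    obtain ⟨k, _, hk⟩ := hcov r
      (Finset.mem_insert_of_mem (Finset.mem_union_left _ (Finset.mem_image_of_mem _ r.2)))
    rcases le_total k m with hkm | hkm
    · exact ⟨k, hkm, hk⟩
    · exact ⟨m, le_rfl, le_antisymm ((ht hkm).trans_eq hk) (r.1.2.trans_eq hm.symm)⟩
  have hJ : ∀ u : J, ∃ k, m ≤ k ∧ k ≤ N ∧ t k = s + u := by
    intro u
    obtain ⟨k, hkN, hk⟩ := hcov (s + u)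
      (Finset.mem_insert_of_mem (Finset.mem_union_right _ (Finset.mem_image_of_mem _ u.2)))
    rcases le_total m k with hkm | hkm
    · exact ⟨k, hkm, hkN, hk⟩
    · refine ⟨m, le_rfl, hmN, le_antisymm (hm.trans_le le_self_add) (hk.symm.trans_le (ht hkm))⟩
  choose k hkm hk using hI
  choose l hml hlN hl using hJ
  -- Past values use only increments with index below m, future ones only those from m on: disjoint
  -- blocks of an independent family.
  have key := (hY.nat ht).indepFun_finset (Finset.range m) (Finset.Ico m N)
    (Finset.disjoint_left.2 fun i hi hi' => by simp at hi hi'; omega)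
    (fun i => (hYm _).sub (hYm _))
  let F : ((Finset.range m) → ℝ) → I → ℝ := fun y i =>
    ∑ j : Finset.range m, if (j : ℕ) < k i then y j else 0
  let G : ((Finset.Ico m N) → ℝ) → J → ℝ := fun y i =>
    ∑ j : Finset.Ico m N, if (j : ℕ) < l i then y j else 0
  have hF : Measurable F := by
    refine measurable_pi_lambda _ fun i => Finset.measurable_sum _ fun j _ => ?_
    split_ifs <;> fun_prop
  have hG : Measurable G := by
    refine measurable_pi_lambda _ fun i => Finset.measurable_sum _ fun j _ => ?_
    split_ifs <;> fun_prop
  convert! key.comp hF hG using 1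
  · ext ω i
    simp only [F, Function.comp_apply]
    rw [Finset.sum_coe_sort (Finset.range m)
      (fun j => if j < k i then Y (t (j + 1)) ω - Y (t j) ω else 0), ← Finset.sum_filter]
    have : (Finset.range m).filter (fun j => j < k i) = Finset.range (k i) := by
      ext j; have := hkm i; simp; omega
    rw [this, Finset.sum_range_sub (fun j => Y (t j) ω), hk, ht0, hY0, sub_zero]
  · ext ω i
    simp only [G, Function.comp_apply]
    rw [Finset.sum_coe_sort (Finset.Ico m N)
      (fun j => if j < l i then Y (t (j + 1)) ω - Y (t j) ω else 0), ← Finset.sum_filter]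
    have : (Finset.Ico m N).filter (fun j => j < l i) = Finset.Ico m (l i) := by
      ext j; have := hlN i; simp; omega
    rw [this, Finset.sum_Ico_sub (fun j => Y (t j) ω) (hml i), hl, hm]

/-- If `A` is independent of `(B, C)` and `B` is independent of `C`, then `(A, B)` is independent
of `C`. -/
theorem indepFun_prodMk_left {α β γ : Type*} [MeasurableSpace α] [MeasurableSpace β]
    [MeasurableSpace γ] {A : Ω → α} {B : Ω → β} {C : Ω → γ} (hA : Measurable A)
    (hB : Measurable B) (hC : Measurable C) (hABC : IndepFun A (fun ω => (B ω, C ω)) P)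
    (hBC : IndepFun B C P) : IndepFun (fun ω => (A ω, B ω)) C P := by
  have := Measure.isProbabilityMeasure_map (μ := P) hA.aemeasurable
  have := Measure.isProbabilityMeasure_map (μ := P) hB.aemeasurable
  have := Measure.isProbabilityMeasure_map (μ := P) hC.aemeasurable
  have hAB : IndepFun A B P := hABC.comp measurable_id measurable_fst
  rw [indepFun_iff_map_prod_eq_prod_map_map (by fun_prop) (by fun_prop)] at hABC hBC hAB ⊢
  -- Both sides are the threefold product law, bracketed differently.
  rw [hAB, ← MeasurableEquiv.prodAssoc.map_measurableEquiv_injective.eq_iff,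
    Measure.prodAssoc_prod, ← hBC, ← hABC, Measure.map_map (by fun_prop) (by fun_prop)]
  rfl

/-- The increments of a process with stationary independent increments after a fixed time form
a process with the same law. -/
theorem identDistrib_future (hYm : ∀ t, Measurable (Y t)) (hY0 : ∀ ω, Y 0 ω = 0)
    (hY : HasIndepIncrements Y P)
    (hst : ∀ s t : ℝ≥0, IdentDistrib (fun ω => Y (s + t) ω - Y s ω) (Y t) P P) (s : ℝ≥0) :
    IdentDistrib (fun ω t => Y (s + t) ω - Y s ω) (fun ω t => Y t ω) P P := by
  have incr : ∀ a b : ℝ≥0, a ≤ b → IdentDistrib (fun ω => Y b ω - Y a ω) (Y (b - a)) P P := by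
    intro a b hab
    have := hst a (b - a)
    rwa [add_tsub_cancel_of_le hab] at this
  refine identDistrib_process_of_indepIncrements (Y := fun t ω => Y (s + t) ω - Y s ω)
    (fun t => (hYm _).sub (hYm _)) hYm (fun ω => by simp) hY0 ?_ hY fun a b hab => ?_
  · intro n t ht
    simp only [sub_sub_sub_cancel_right]
    exact hY n (fun i => s + t i) fun i j hij => add_le_add le_rfl (ht hij)
  · simp only [sub_sub_sub_cancel_right]
    have := incr (s + a) (s + b) (by gcongr)
    rw [add_tsub_add_eq_tsub_left] at this
    exact this.trans (incr a b hab).symm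

end

/-! ### Regular paths and the strong Markov property. -/

/-- The approximation of `t` from above on the grid of mesh `1 / (n + 1)`. -/
noncomputable def gridAbove (n : ℕ) (t : ℝ≥0) : ℝ≥0 := (⌊(n + 1) * t⌋₊ + 1) / (n + 1)

/-- Strictness matters: {T < s} is known to lie in the past of s, but {T ≤ s} is not. The
approximation takes the value (k+1)/(n+1) exactly when k/(n+1) ≤ T < (k+1)/(n+1), an event of the
past at (k+1)/(n+1). -/
theorem lt_gridAbove (n : ℕ) (t : ℝ≥0) : t < gridAbove n t := by
  rw [gridAbove, lt_div_iff₀ (by positivity), mul_comm]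
  exact Nat.lt_floor_add_one _

theorem gridAbove_le (n : ℕ) (t : ℝ≥0) : gridAbove n t ≤ t + 1 / (n + 1) := by
  rw [gridAbove, add_div]
  gcongr
  rw [div_le_iff₀ (by positivity), mul_comm]
  exact Nat.floor_le zero_le

theorem tendsto_gridAbove (t : ℝ≥0) : Tendsto (fun n => gridAbove n t) atTop (𝓝[≥] t) := by
  refine tendsto_nhdsWithin_iff.2 ⟨?_, Eventually.of_forall fun n => (lt_gridAbove n t).le⟩
  refine tendsto_of_tendsto_of_tendsto_of_le_of_le tendsto_const_nhds ?_
    (fun n => (lt_gridAbove n t).le) (fun n => gridAbove_le n t)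
  simpa using (tendsto_const_nhds (x := t)).add (tendsto_one_div_add_atTop_nhds_zero_nat (𝕜 := ℝ≥0))

/-- A random variable `X₀ > 0` together with an independent process `Z` with stationary independent
increments, all of whose paths start at zero, are nondecreasing, right-continuous and unbounded. -/
structure IsRegularLevyPair {Ω : Type*} [MeasurableSpace Ω] (P : Measure Ω)
    (X₀ : Ω → ℝ) (Z : ℝ≥0 → Ω → ℝ) : Prop where
  measurable_start : Measurable X₀
  measurable : ∀ t, Measurable (Z t)
  zero : ∀ ω, Z 0 ω = 0
  mono : ∀ ω, Monotone fun t => Z t ω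
  rightCont : ∀ ω t, ContinuousWithinAt (fun s => Z s ω) (Ici t) t
  pos : ∀ ω, 0 < X₀ ω
  unbounded : ∀ ω x, ∃ t, x < Z t ω
  indep : HasIndepIncrements Z P
  stat : ∀ s t : ℝ≥0, IdentDistrib (fun ω => Z (s + t) ω - Z s ω) (Z t) P P
  indep_start : IndepFun X₀ (fun ω t => Z t ω) P

/-- The information available at time `s`. -/
@[reducible]
def pastSigma {Ω : Type*} (X₀ : Ω → ℝ) (Z : ℝ≥0 → Ω → ℝ) (s : ℝ≥0) : MeasurableSpace Ω :=
  MeasurableSpace.comap (fun ω => (X₀ ω, fun r : Iic s => Z r ω)) inferInstance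

section
variable {Ω : Type*} {X₀ : Ω → ℝ} {Z : ℝ≥0 → Ω → ℝ}

theorem measurable_past_pair (s : ℝ≥0) :
    Measurable[pastSigma X₀ Z s] fun ω => (X₀ ω, fun r : Iic s => Z r ω) :=
  comap_measurable _

theorem measurable_past_start (s : ℝ≥0) : Measurable[pastSigma X₀ Z s] X₀ :=
  measurable_fst.comp (measurable_past_pair s)

theorem measurable_past {r s : ℝ≥0} (h : r ≤ s) : Measurable[pastSigma X₀ Z s] (Z r) :=
  (measurable_pi_apply (⟨r, h⟩ : Iic s)).comp (measurable_snd.comp (measurable_past_pair s))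

theorem pastSigma_mono {s t : ℝ≥0} (h : s ≤ t) : pastSigma X₀ Z s ≤ pastSigma X₀ Z t := by
  refine measurable_iff_comap_le.1 ?_
  exact (measurable_past_start t).prodMk (@measurable_pi_lambda _ _ _ (pastSigma X₀ Z t) _
    (fun ω (r : Iic s) => Z r ω) fun r => measurable_past (r.2.trans h))

end

section
variable {Ω : Type*} [MeasurableSpace Ω] {P : Measure Ω}
  {X₀ : Ω → ℝ} {Z : ℝ≥0 → Ω → ℝ}

theorem measurable_gridAbove (n : ℕ) : Measurable (gridAbove n) := by
  unfold gridAbove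
  have : Measurable fun t : ℝ≥0 => ⌊((n : ℝ≥0) + 1) * t⌋₊ := by fun_prop
  have h2 : Measurable fun k : ℕ => ((k : ℝ≥0) + 1) / (n + 1) := measurable_of_countable _
  exact h2.comp this

namespace IsRegularLevyPair

theorem tendsto_right (h : IsRegularLevyPair P X₀ Z) (ω : Ω) {t : ℝ≥0} {f : ℕ → ℝ≥0}
    (hf : Tendsto f atTop (𝓝[≥] t)) : Tendsto (fun n => Z (f n) ω) atTop (𝓝 (Z t ω)) :=
  (h.rightCont ω t).tendsto.comp hf

theorem measurable_uncurry_gridAbove (h : IsRegularLevyPair P X₀ Z) (n : ℕ) :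
    Measurable fun p : ℝ≥0 × Ω => Z (gridAbove n p.1) p.2 := by
  have h1 : ∀ s : ℕ → ℝ≥0, Measurable fun q : Ω × ℕ => Z (s q.2) q.1 := fun s =>
    measurable_from_prod_countable_left fun k => h.measurable (s k)
  have h2 : Measurable fun p : ℝ≥0 × Ω => (p.2, ⌊((n : ℝ≥0) + 1) * p.1⌋₊) := by fun_prop
  have h3 := (h1 fun k => ((k : ℝ≥0) + 1) / (n + 1)).comp h2
  simp only [gridAbove]
  simpa only [Function.comp_def] using h3

/-- Right-continuity makes the process a pointwise limit of step processes, hence jointly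
measurable; this allows random times to be inserted and Fubini to be used. -/
theorem measurable_uncurry (h : IsRegularLevyPair P X₀ Z) :
    Measurable fun p : ℝ≥0 × Ω => Z p.1 p.2 :=
  measurable_of_tendsto_metrizable h.measurable_uncurry_gridAbove
    (tendsto_pi_nhds.2 fun p => h.tendsto_right p.2 (tendsto_gridAbove p.1))

end IsRegularLevyPair
end

section
variable {Ω : Type*} [MeasurableSpace Ω] {P : Measure Ω} [IsProbabilityMeasure P]
  {X₀ : Ω → ℝ} {Z : ℝ≥0 → Ω → ℝ}

namespace IsRegularLevyPair

theorem indepFun_past (h : IsRegularLevyPair P X₀ Z) (s : ℝ≥0) :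
    IndepFun (fun ω => (X₀ ω, fun r : Iic s => Z r ω)) (fun ω t => Z (s + t) ω - Z s ω) P := by
  refine indepFun_prodMk_left h.measurable_start (measurable_pi_lambda _ fun r => h.measurable _)
    (measurable_pi_lambda _ fun t => (h.measurable _).sub (h.measurable _)) ?_
    (indepFun_past_future h.measurable h.zero h.indep s)
  have hF : Measurable fun z : ℝ≥0 → ℝ =>
      ((fun r : Iic s => z r, fun t => z (s + t) - z s) : (Iic s → ℝ) × (ℝ≥0 → ℝ)) := by
    fun_prop
  exact h.indep_start.comp measurable_id hF

end IsRegularLevyPair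

/-- If, on each event `{N = k}`, the variable `V k` has law `ρ` independently of `U k`, then `V N`
has law `ρ` and is independent of `U N`. -/
theorem map_prodMk_randomIndex {α β : Type*} [MeasurableSpace α] [MeasurableSpace β]
    {N : Ω → ℕ} {U : ℕ → Ω → α} {V : ℕ → Ω → β} {ρ : Measure β} [SigmaFinite ρ]
    (hN : Measurable N) (hU : ∀ k, Measurable (U k)) (hV : ∀ k, Measurable (V k))
    (h : ∀ k A B, MeasurableSet A → MeasurableSet B →
      P ((N ⁻¹' {k} ∩ U k ⁻¹' A) ∩ V k ⁻¹' B) = P (N ⁻¹' {k} ∩ U k ⁻¹' A) * ρ B) :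
    P.map (fun ω => (U (N ω) ω, V (N ω) ω)) = (P.map fun ω => U (N ω) ω).prod ρ := by
  have hUN : Measurable fun ω => U (N ω) ω :=
    (measurable_from_prod_countable_left (f := fun p : Ω × ℕ => U p.2 p.1) hU).comp
      (measurable_id.prodMk hN)
  have hVN : Measurable fun ω => V (N ω) ω :=
    (measurable_from_prod_countable_left (f := fun p : Ω × ℕ => V p.2 p.1) hV).comp
      (measurable_id.prodMk hN)
  have := Measure.isProbabilityMeasure_map (μ := P) hUN.aemeasurable
  refine (Measure.prod_eq fun A B hA hB => ?_).symm
  have split : ∀ S : Set Ω, MeasurableSet S → P S = ∑' k, P (N ⁻¹' {k} ∩ S) := by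
    intro S hS
    rw [← measure_iUnion]
    · rw [← iUnion_inter, ← preimage_iUnion, iUnion_of_singleton, preimage_univ, univ_inter]
    · intro i j hij
      refine disjoint_left.2 fun ω h1 h2 => hij ?_
      rw [← show N ω = i from h1.1, ← show N ω = j from h2.1]
    · exact fun k => (hN (measurableSet_singleton k)).inter hS
  rw [Measure.map_apply (hUN.prodMk hVN) (hA.prod hB), Measure.map_apply hUN hA,
    split _ (hUN.prodMk hVN (hA.prod hB)), split _ (hUN hA), ← ENNReal.tsum_mul_right]
  refine tsum_congr fun k => ?_
  have e1 : N ⁻¹' {k} ∩ (fun ω => (U (N ω) ω, V (N ω) ω)) ⁻¹' A ×ˢ B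
      = (N ⁻¹' {k} ∩ U k ⁻¹' A) ∩ V k ⁻¹' B := by
    ext ω
    simp only [mem_inter_iff, mem_preimage, mem_singleton_iff, mem_prod]
    constructor
    · rintro ⟨rfl, h1, h2⟩; exact ⟨⟨rfl, h1⟩, h2⟩
    · rintro ⟨⟨rfl, h1⟩, h2⟩; exact ⟨rfl, h1, h2⟩
  have e2 : N ⁻¹' {k} ∩ (fun ω => U (N ω) ω) ⁻¹' A = N ⁻¹' {k} ∩ U k ⁻¹' A := by
    ext ω
    simp only [mem_inter_iff, mem_preimage, mem_singleton_iff]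
    constructor
    · rintro ⟨rfl, h1⟩; exact ⟨rfl, h1⟩
    · rintro ⟨rfl, h1⟩; exact ⟨rfl, h1⟩
  rw [e1, e2, h k A B hA hB]

namespace IsRegularLevyPair

/-- The Markov property at the grid approximations of an optional time. -/
theorem markov_gridAbove (h : IsRegularLevyPair P X₀ Z) {T : Ω → ℝ≥0} (hTm : Measurable T)
    (hT : ∀ s, MeasurableSet[pastSigma X₀ Z s] {ω | T ω < s}) {ι : Type*} (q : ι → ℝ≥0)
    (n : ℕ) :
    P.map (fun ω => (X₀ ω + Z (gridAbove n (T ω)) ω,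
        fun i => Z (gridAbove n (T ω) + q i) ω - Z (gridAbove n (T ω)) ω))
      = (P.map fun ω => X₀ ω + Z (gridAbove n (T ω)) ω).prod (P.map fun ω i => Z (q i) ω) := by
  have hq : Measurable fun ω i => Z (q i) ω := measurable_pi_lambda _ fun i => h.measurable _
  have := Measure.isProbabilityMeasure_map (μ := P) hq.aemeasurable
  let s : ℕ → ℝ≥0 := fun k => (k + 1) / (n + 1)
  refine map_prodMk_randomIndex (N := fun ω => ⌊((n : ℝ≥0) + 1) * T ω⌋₊)
    (U := fun k ω => X₀ ω + Z (s k) ω) (V := fun k ω i => Z (s k + q i) ω - Z (s k) ω)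
    (by fun_prop) (fun k => h.measurable_start.add (h.measurable _))
    (fun k => measurable_pi_lambda _ fun i => (h.measurable _).sub (h.measurable _))
    fun k A B hA hB => ?_
  have hpast : MeasurableSet[pastSigma X₀ Z (s k)]
      ((fun ω => ⌊((n : ℝ≥0) + 1) * T ω⌋₊) ⁻¹' {k} ∩ (fun ω => X₀ ω + Z (s k) ω) ⁻¹' A) := by
    refine @MeasurableSet.inter _ (pastSigma X₀ Z (s k)) _ _ ?_ ?_
    · have : (fun ω => ⌊((n : ℝ≥0) + 1) * T ω⌋₊) ⁻¹' {k}
          = {ω | T ω < s k} \ {ω | T ω < (k : ℝ≥0) / (n + 1)} := by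
        ext ω
        simp only [mem_preimage, mem_singleton_iff, Set.mem_sdiff, mem_ofPred_eq, not_lt, s]
        rw [Nat.floor_eq_iff zero_le, lt_div_iff₀ (by positivity), div_le_iff₀ (by positivity),
          mul_comm, and_comm]
      rw [this]
      refine @MeasurableSet.diff _ (pastSigma X₀ Z (s k)) _ _ (hT _) (pastSigma_mono ?_ _ (hT _))
      simp only [s]
      gcongr
      exact le_self_add
    · exact (@Measurable.add _ _ _ _ (pastSigma X₀ Z (s k)) _ _ _ (measurable_past_start _)
        (measurable_past le_rfl)) hA
  have hind := (IndepFun_iff_Indep _ _ _).1 (h.indepFun_past (s k))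
  have hres : Measurable fun (z : ℝ≥0 → ℝ) i => z (q i) := by fun_prop
  have h1 := (Indep_iff _ _ _).1 hind _ _ hpast ⟨_, hres hB, rfl⟩
  have hlaw := ((identDistrib_future h.measurable h.zero h.indep h.stat (s k)).comp hres).map_eq
  have hVm : Measurable fun ω i => Z (s k + q i) ω - Z (s k) ω :=
    measurable_pi_lambda _ fun i => (h.measurable _).sub (h.measurable _)
  have h2 : P ((fun ω i => Z (s k + q i) ω - Z (s k) ω) ⁻¹' B)
      = (P.map fun ω i => Z (q i) ω) B := by
    rw [← Measure.map_apply hVm hB]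
    exact congrArg (fun μ : Measure (ι → ℝ) => μ B) hlaw
  rw [← h2]
  exact h1

/-- The strong Markov property. -/
theorem strong_markov (h : IsRegularLevyPair P X₀ Z) {T : Ω → ℝ≥0} (hTm : Measurable T)
    (hT : ∀ s, MeasurableSet[pastSigma X₀ Z s] {ω | T ω < s}) {ι : Type*} [Countable ι]
    (q : ι → ℝ≥0) :
    P.map (fun ω => (X₀ ω + Z (T ω) ω, fun i => Z (T ω + q i) ω - Z (T ω) ω))
      = (P.map fun ω => X₀ ω + Z (T ω) ω).prod (P.map fun ω i => Z (q i) ω) := by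
  have meas : ∀ S : Ω → ℝ≥0, Measurable S → Measurable fun ω => Z (S ω) ω := fun S hS =>
    h.measurable_uncurry.comp (hS.prodMk measurable_id)
  have measX : ∀ S : Ω → ℝ≥0, Measurable S → Measurable fun ω => X₀ ω + Z (S ω) ω :=
    fun S hS => h.measurable_start.add (meas S hS)
  have measV : ∀ S : Ω → ℝ≥0, Measurable S →
      Measurable fun ω i => Z (S ω + q i) ω - Z (S ω) ω := fun S hS =>
    measurable_pi_lambda _ fun i => (meas (fun ω => S ω + q i) (hS.add_const _)).sub (meas S hS)
  have measS : ∀ n, Measurable fun ω => gridAbove n (T ω) := fun n =>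
    (measurable_gridAbove n).comp hTm
  have hq : Measurable fun ω i => Z (q i) ω := measurable_pi_lambda _ fun i => h.measurable _
  have := Measure.isProbabilityMeasure_map (μ := P) hq.aemeasurable
  have := Measure.isProbabilityMeasure_map (μ := P) (measX T hTm).aemeasurable
  have := Measure.isProbabilityMeasure_map (μ := P)
    ((measX T hTm).prodMk (measV T hTm)).aemeasurable
  -- Products of bounded continuous functions determine the joint law and survive the limit: the
  -- grid times decrease to T within the right neighbourhood of T, where paths are continuous.
  refine Measure.eq_prod_of_integral_mul_boundedContinuousFunction fun f g => ?_
  have hf := f.continuous.measurable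
  have hg := g.continuous.measurable
  rw [integral_map ((measX T hTm).prodMk (measV T hTm)).aemeasurable
      (by fun_prop), integral_map (measX T hTm).aemeasurable (by fun_prop)]
  have grid : ∀ n, ∫ ω, f (X₀ ω + Z (gridAbove n (T ω)) ω)
        * g (fun i => Z (gridAbove n (T ω) + q i) ω - Z (gridAbove n (T ω)) ω) ∂P
      = (∫ ω, f (X₀ ω + Z (gridAbove n (T ω)) ω) ∂P) * ∫ z, g z ∂P.map fun ω i => Z (q i) ω := by
    intro n
    have hX := measX _ (measS n)
    have hV := measV _ (measS n)
    have := Measure.isProbabilityMeasure_map (μ := P) hX.aemeasurable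
    have e1 := integral_map (μ := P) (hX.prodMk hV).aemeasurable
      (f := fun p : ℝ × (ι → ℝ) => f p.1 * g p.2) (by fun_prop)
    rw [← e1, h.markov_gridAbove hTm hT q n, integral_prod_mul,
      integral_map hX.aemeasurable (by fun_prop)]
  have limX : ∀ ω, Tendsto (fun n => X₀ ω + Z (gridAbove n (T ω)) ω) atTop
      (𝓝 (X₀ ω + Z (T ω) ω)) := fun ω =>
    (h.tendsto_right ω (tendsto_gridAbove _)).const_add _
  have limV : ∀ ω, Tendsto
      (fun n i => Z (gridAbove n (T ω) + q i) ω - Z (gridAbove n (T ω)) ω) atTop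
      (𝓝 fun i => Z (T ω + q i) ω - Z (T ω) ω) := by
    intro ω
    refine tendsto_pi_nhds.2 fun i => ?_
    refine (h.tendsto_right ω ?_).sub (h.tendsto_right ω (tendsto_gridAbove _))
    refine tendsto_nhdsWithin_iff.2 ⟨?_, Eventually.of_forall fun n => ?_⟩
    · exact (tendsto_nhds_of_tendsto_nhdsWithin (tendsto_gridAbove _)).add_const _
    · exact add_le_add (lt_gridAbove _ _).le le_rfl
  have lim1 := tendsto_integral_of_dominated_convergence (μ := P) (fun _ => ‖f‖ * ‖g‖)
    (F := fun n ω => f (X₀ ω + Z (gridAbove n (T ω)) ω)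
        * g (fun i => Z (gridAbove n (T ω) + q i) ω - Z (gridAbove n (T ω)) ω))
    (f := fun ω => f (X₀ ω + Z (T ω) ω) * g (fun i => Z (T ω + q i) ω - Z (T ω) ω))
    (fun n => ((hf.comp (measX _ (measS n))).mul
      (hg.comp (measV _ (measS n)))).aestronglyMeasurable)
    (integrable_const _)
    (fun n => ae_of_all _ fun ω => by
      rw [norm_mul]
      exact mul_le_mul (f.norm_coe_le_norm _) (g.norm_coe_le_norm _) (norm_nonneg _)
        (norm_nonneg _))
    (ae_of_all _ fun ω => ((f.continuous.tendsto _).comp (limX ω)).mul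
      ((g.continuous.tendsto _).comp (limV ω)))
  have lim2 := tendsto_integral_of_dominated_convergence (μ := P) (fun _ => ‖f‖)
    (F := fun n ω => f (X₀ ω + Z (gridAbove n (T ω)) ω))
    (f := fun ω => f (X₀ ω + Z (T ω) ω))
    (fun n => (hf.comp (measX _ (measS n))).aestronglyMeasurable)
    (integrable_const _)
    (fun n => ae_of_all _ fun ω => f.norm_coe_le_norm _)
    (ae_of_all _ fun ω => (f.continuous.tendsto _).comp (limX ω))
  simp_rw [grid] at lim1
  exact tendsto_nhds_unique lim1 (lim2.mul_const _)

end IsRegularLevyPair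
end

/-! ### First passage times of monotone paths. -/

section
variable {Ω : Type*} {X : ℝ≥0 → Ω → ℝ} {a : ℝ≥0} {ω : Ω}

theorem lt_of_firstPassage_lt (hmono : Monotone fun t => X t ω) (hunb : ∃ t, (a : ℝ) < X t ω)
    {t : ℝ≥0} (ht : firstPassage X a ω < t) : (a : ℝ) < X t ω := by
  obtain ⟨s, hs, hst⟩ := (csInf_lt_iff (OrderBot.bddBelow _) hunb).1 ht
  exact lt_of_lt_of_le hs (hmono hst.le)

theorem firstPassage_le {t : ℝ≥0} (ht : (a : ℝ) < X t ω) : firstPassage X a ω ≤ t :=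
  csInf_le (OrderBot.bddBelow _) ht

/-- A dense time between the passage time and s already has the path above a. The event is thus a
countable union over times before s, which makes T_a an optional time. -/
theorem firstPassage_lt_iff (hmono : Monotone fun t => X t ω) (hunb : ∃ t, (a : ℝ) < X t ω)
    {s : ℝ≥0} :
    firstPassage X a ω < s ↔ ∃ i, denseSeq ℝ≥0 i < s ∧ (a : ℝ) < X (denseSeq ℝ≥0 i) ω := by
  constructor
  · intro h
    obtain ⟨r, ⟨i, rfl⟩, hr, hrs⟩ := Dense.exists_between (denseRange_denseSeq ℝ≥0) h
    exact ⟨i, hrs, lt_of_firstPassage_lt hmono hunb hr⟩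
  · rintro ⟨i, his, hi⟩
    exact (firstPassage_le hi).trans_lt his

theorem le_at_firstPassage (hmono : Monotone fun t => X t ω)
    (hrc : ContinuousWithinAt (fun t => X t ω) (Ici (firstPassage X a ω)) (firstPassage X a ω))
    (hunb : ∃ t, (a : ℝ) < X t ω) : (a : ℝ) ≤ X (firstPassage X a ω) ω :=
  ge_of_tendsto (hrc.tendsto.comp (tendsto_gridAbove _)) (Eventually.of_forall fun n =>
    (lt_of_firstPassage_lt hmono hunb (lt_gridAbove n _)).le)

/-- The first passage time above the level `a`, read off from the values of a path at a dense
sequence of times. -/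
noncomputable def passageFunctional (a : ℝ≥0) (y : ℕ → ℝ) : ℝ :=
  -- Working in `ℝ≥0∞` lets the times at which the level is not exceeded drop out of the infimum as
  -- ∞.
  (⨅ i, if (a : ℝ) < y i then (denseSeq ℝ≥0 i : ℝ≥0∞) else ∞).toReal

theorem measurable_passageFunctional (a : ℝ≥0) : Measurable (passageFunctional a) := by
  refine (Measurable.iInf fun i => ?_).ennreal_toReal
  exact Measurable.ite (measurableSet_lt measurable_const (measurable_pi_apply i))
    measurable_const measurable_const

theorem firstPassage_eq_passageFunctional (hmono : Monotone fun t => X t ω)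
    (hunb : ∃ t, (a : ℝ) < X t ω) :
    (firstPassage X a ω : ℝ) = passageFunctional a fun i => X (denseSeq ℝ≥0 i) ω := by
  suffices h : (⨅ i, if (a : ℝ) < X (denseSeq ℝ≥0 i) ω then (denseSeq ℝ≥0 i : ℝ≥0∞) else ∞)
      = (firstPassage X a ω : ℝ≥0∞) by
    rw [passageFunctional, h, ENNReal.coe_toReal]
  refine le_antisymm (ENNReal.le_of_forall_pos_le_add fun ε hε _ => ?_) (le_iInf fun i => ?_)
  · obtain ⟨i, his, hi⟩ := (firstPassage_lt_iff hmono hunb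
      (s := firstPassage X a ω + ε)).1 (lt_add_of_pos_right _ hε)
    refine (iInf_le _ i).trans ?_
    rw [if_pos hi]
    exact_mod_cast his.le
  · split_ifs with hi
    · exact_mod_cast firstPassage_le hi
    · exact le_top

/-- After the passage above the level `a`, the passage above `a + b` is the passage of the
re-centred path above `b`. -/
theorem firstPassage_add (hmono : Monotone fun t => X t ω) {b : ℝ≥0}
    (hunb : ∃ t, ((a + b : ℝ≥0) : ℝ) < X t ω) :
    firstPassage X (a + b) ω
      = firstPassage X a ω
        + firstPassage (fun t ω => X (firstPassage X a ω + t) ω - a) b ω := by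
  have hunb_a : ∃ t, (a : ℝ) < X t ω := by
    obtain ⟨t, ht⟩ := hunb
    exact ⟨t, lt_of_le_of_lt (by simp) ht⟩
  set T := firstPassage X a ω with hT
  have mem : ∀ t, ((a + b : ℝ≥0) : ℝ) < X (T + t) ω ↔ (b : ℝ) < X (T + t) ω - a := by
    intro t
    push_cast
    constructor <;> intro h <;> linarith
  have hge : ∀ t, ((a + b : ℝ≥0) : ℝ) < X t ω → T ≤ t := fun t ht =>
    firstPassage_le (lt_of_le_of_lt (by simp) ht)
  have hne : ∃ t, (b : ℝ) < X (T + t) ω - a := by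
    obtain ⟨t, ht⟩ := hunb
    exact ⟨t, (mem t).1 (ht.trans_le (hmono le_add_self))⟩
  refine le_antisymm ?_ (le_csInf hunb fun t ht => ?_)
  · rw [← tsub_le_iff_left]
    refine le_csInf hne fun t ht => ?_
    rw [tsub_le_iff_left]
    exact firstPassage_le ((mem t).2 ht)
  · obtain ⟨s, rfl⟩ := exists_add_of_le (hge t ht)
    exact add_le_add le_rfl (csInf_le (OrderBot.bddBelow _) ((mem s).1 ht))

theorem firstPassage_zero (h : 0 < X 0 ω) : firstPassage X 0 ω = 0 :=
  le_antisymm (firstPassage_le (by simpa using h)) zero_le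

end

namespace IsRegularLevyPair

variable {Ω : Type*} [MeasurableSpace Ω] {P : Measure Ω} {X₀ : Ω → ℝ} {Z : ℝ≥0 → Ω → ℝ}

theorem monotone_path (h : IsRegularLevyPair P X₀ Z) (ω : Ω) :
    Monotone fun t => X₀ ω + Z t ω := (h.mono ω).const_add _

theorem exists_lt (h : IsRegularLevyPair P X₀ Z) (ω : Ω) (a : ℝ) : ∃ t, a < X₀ ω + Z t ω := by
  obtain ⟨t, ht⟩ := h.unbounded ω a
  exact ⟨t, by linarith [h.pos ω]⟩

theorem measurableSet_firstPassage_lt (h : IsRegularLevyPair P X₀ Z) (a s : ℝ≥0) :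
    MeasurableSet[pastSigma X₀ Z s]
      {ω | firstPassage (fun t ω => X₀ ω + Z t ω) a ω < s} := by
  have : {ω | firstPassage (fun t ω => X₀ ω + Z t ω) a ω < s}
      = ⋃ i, {ω | denseSeq ℝ≥0 i < s ∧ (a : ℝ) < X₀ ω + Z (denseSeq ℝ≥0 i) ω} := by
    ext ω
    rw [mem_iUnion]
    exact firstPassage_lt_iff (X := fun t ω => X₀ ω + Z t ω) (h.monotone_path ω) (h.exists_lt ω a)
  rw [this]
  refine @MeasurableSet.iUnion _ _ (pastSigma X₀ Z s) _ _ fun i => ?_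
  by_cases his : denseSeq ℝ≥0 i < s
  · simp only [his, true_and]
    exact (@Measurable.add _ _ _ _ (pastSigma X₀ Z s) _ _ _ (measurable_past_start s)
      (measurable_past his.le)) measurableSet_Ioi
  · simp [his]

theorem measurable_firstPassage (h : IsRegularLevyPair P X₀ Z) (a : ℝ≥0) :
    Measurable (firstPassage (fun t ω => X₀ ω + Z t ω) a) := by
  refine measurable_of_Iio fun s => ?_
  refine (measurable_iff_comap_le.1 ?_) _ (h.measurableSet_firstPassage_lt a s)
  exact h.measurable_start.prodMk (measurable_pi_lambda _ fun r => h.measurable _)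

end IsRegularLevyPair

/-! ### Laplace transform of the integrated-tail law. -/

theorem lintegral_exp_neg_mul_Ioi {a : ℝ} (ha : 0 < a) (c : ℝ) :
    ∫⁻ t in Ioi c, ENNReal.ofReal (Real.exp (-(a * t)))
      = ENNReal.ofReal (Real.exp (-(a * c)) / a) := by
  have h1 := integrableOn_exp_mul_Ioi (neg_neg_of_pos ha) c
  have h2 := integral_exp_mul_Ioi (neg_neg_of_pos ha) c
  simp only [neg_mul, neg_div_neg_eq] at h1 h2
  rw [← h2, ofReal_integral_eq_lintegral_ofReal h1 (ae_of_all _ fun t => (Real.exp_pos _).le)]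

theorem lintegral_exp_neg_mul_Ioo {u x : ℝ} (hu : 0 < u) (hx : 0 ≤ x) :
    ∫⁻ t in Ioo 0 x, ENNReal.ofReal (Real.exp (-(u * t)))
      = ENNReal.ofReal ((1 - Real.exp (-(u * x))) / u) := by
  have h1 : ∫ t in 0..x, Real.exp (-(u * t)) = (1 - Real.exp (-(u * x))) / u := by
    have := intervalIntegral.integral_comp_mul_left (a := 0) (b := x) Real.exp
      (neg_ne_zero.2 hu.ne')
    simp only [neg_mul] at this
    rw [this, integral_exp]
    simp
    field_simp
    ring
  rw [← h1, intervalIntegral.integral_of_le hx, Measure.restrict_congr_set Ioo_ae_eq_Ioc,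
    ofReal_integral_eq_lintegral_ofReal
      ((Continuous.integrableOn_Icc (by fun_prop)).mono_set Ioc_subset_Icc_self)
      (ae_of_all _ fun t => (Real.exp_pos _).le)]

section LevyMeasure
variable {ν : Measure ℝ}

theorem IsSubordinatorLevyMeasure.ae_pos (hν : IsSubordinatorLevyMeasure ν) : ∀ᵐ x ∂ν, 0 < x := by
  rw [ae_iff]
  convert hν.carried_by_pos using 2
  ext x
  simp

/-- The measure x ν(dx) is finite, and ν is recovered from it by the density 1/x, since ν charges
only x > 0. Fubini against ν needs this. -/
theorem sFinite_of_levyMean_lt_top (hν : IsSubordinatorLevyMeasure ν) (hfin : levyMean ν < ∞) :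
    SFinite ν := by
  have h1 := isFiniteMeasure_withDensity (μ := ν) (f := fun x => ENNReal.ofReal x) hfin.ne
  have h2 := withDensity_inv_same (μ := ν) ENNReal.measurable_ofReal
    (hν.ae_pos.mono fun x hx => by simpa using hx) (ae_of_all _ fun x => ENNReal.ofReal_ne_top)
  rw [← h2]
  infer_instance

theorem measurable_tail (ν : Measure ℝ) : Measurable fun y => ν (Ioi y) :=
  Antitone.measurable fun _ _ h => measure_mono (Ioi_subset_Ioi h)

/-- Integration by parts against the tail of a measure. -/
theorem lintegral_mul_tail (ν : Measure ℝ) [SFinite ν] {g : ℝ → ℝ≥0∞} (hg : Measurable g) :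
    ∫⁻ y in Ioi 0, g y * ν (Ioi y) = ∫⁻ x, (∫⁻ y in Ioo 0 x, g y) ∂ν := by
  let s : Set (ℝ × ℝ) := {p | p.1 < p.2}
  have hs : MeasurableSet s := measurableSet_lt measurable_fst measurable_snd
  have e1 : ∀ y, g y * ν (Ioi y) = ∫⁻ x, s.indicator (fun p => g p.1) (y, x) ∂ν := by
    intro y
    have : ∀ x, s.indicator (fun p => g p.1) (y, x) = (Ioi y).indicator (fun _ => g y) x := by
      intro x; simp [s, indicator]
    simp_rw [this]
    rw [lintegral_indicator_const measurableSet_Ioi]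
  have e2 : ∀ x, ∫⁻ y in Ioo 0 x, g y
      = ∫⁻ y in Ioi 0, s.indicator (fun p => g p.1) (y, x) := by
    intro x
    have : ∀ y, s.indicator (fun p => g p.1) (y, x) = (Iio x).indicator g y := by
      intro y; simp [s, indicator]
    simp_rw [this]
    rw [lintegral_indicator measurableSet_Iio, Measure.restrict_restrict measurableSet_Iio,
      inter_comm, Ioi_inter_Iio]
  simp_rw [e1, e2]
  exact lintegral_lintegral_swap ((hg.comp measurable_fst).indicator hs).aemeasurable

theorem lintegral_one_sub_exp (hν : IsSubordinatorLevyMeasure ν) (hfin : levyMean ν < ∞) {u : ℝ}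
    (hu : 0 ≤ u) :
    ∫⁻ x, ENNReal.ofReal (1 - Real.exp (-(u * x))) ∂ν = ENNReal.ofReal (laplaceExponent ν u) := by
  have hx : Integrable (fun x : ℝ => x) ν :=
    ⟨by fun_prop, by
      rw [hasFiniteIntegral_iff_norm]
      refine lt_of_le_of_lt (le_of_eq (lintegral_congr_ae (hν.ae_pos.mono fun x hx => ?_))) hfin
      simp only [Real.norm_eq_abs, abs_of_pos hx]⟩
  have hnn : ∀ᵐ x ∂ν, 0 ≤ 1 - Real.exp (-(u * x)) := hν.ae_pos.mono fun x hx => by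
    have : 0 ≤ u * x := by positivity
    simpa using this
  rw [laplaceExponent, ofReal_integral_eq_lintegral_ofReal ?_ hnn]
  -- The bound 1 - e^{-ux} ≤ ux and the finite mean give integrability.
  refine (hx.const_mul u).mono' (by fun_prop) ?_
  filter_upwards [hnn] with x hx
  rw [Real.norm_eq_abs, abs_of_nonneg hx]
  linarith [Real.add_one_le_exp (-(u * x))]

theorem laplaceExponent_pos (hν : IsSubordinatorLevyMeasure ν) (hpos : 0 < levyMean ν)
    (hfin : levyMean ν < ∞) {u : ℝ} (hu : 0 < u) : 0 < laplaceExponent ν u := by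
  by_contra hle
  have h1 := lintegral_one_sub_exp hν hfin hu.le
  rw [ENNReal.ofReal_of_nonpos (not_lt.1 hle), lintegral_eq_zero_iff (by fun_prop)] at h1
  have h2 : ∀ᵐ x ∂ν, False := by
    filter_upwards [h1, hν.ae_pos] with x hx hx0
    have : 0 < u * x := by positivity
    simp at hx
    linarith
  have h3 : ν = 0 := by simpa [ae_iff, Filter.eventually_false_iff_eq_bot] using h2
  simp [levyMean, h3] at hpos

variable {Ω : Type*} [MeasurableSpace Ω] {P : Measure Ω} {X₀ : Ω → ℝ}

theorem HasIntegratedTailLaw.ae_pos (hX₀ : HasIntegratedTailLaw X₀ ν P) : ∀ᵐ ω ∂P, 0 < X₀ ω := by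
  rw [ae_iff]
  simpa using hX₀ 0 le_rfl

variable [IsProbabilityMeasure P]

theorem HasIntegratedTailLaw.map_eq (hX₀ : HasIntegratedTailLaw X₀ ν P) (hm : Measurable X₀) :
    P.map X₀ = (levyMean ν)⁻¹ • (volume.restrict (Ioi 0)).withDensity fun y => ν (Ioi y) := by
  have := Measure.isProbabilityMeasure_map (μ := P) hm.aemeasurable
  refine Measure.ext_of_Iic _ _ fun a => ?_
  rw [Measure.map_apply hm measurableSet_Iic, Measure.smul_apply,
    withDensity_apply _ measurableSet_Iic, Measure.restrict_restrict measurableSet_Iic,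
    inter_comm, Ioi_inter_Iic, smul_eq_mul]
  rcases le_or_gt 0 a with ha | ha
  · exact hX₀ a ha
  · rw [Ioc_eq_empty (by linarith), setLIntegral_empty, mul_zero]
    refine measure_mono_null (fun ω hω => ?_) (ae_iff.1 hX₀.ae_pos)
    have : X₀ ω ≤ a := hω
    simp only [mem_ofPred_eq, not_lt]
    linarith

/-- By Fubini, ∫ e^{-uy} ν(y,∞) dy = ∫ (1 - e^{-ux})/u ν(dx). The factor Φ(u) so produced is what
cancels the 1/Φ(u) of the occupation measure. -/
theorem HasIntegratedTailLaw.laplace (hX₀ : HasIntegratedTailLaw X₀ ν P) (hm : Measurable X₀)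
    (hν : IsSubordinatorLevyMeasure ν) (hfin : levyMean ν < ∞) {u : ℝ} (hu : 0 < u) :
    ∫⁻ ω, ENNReal.ofReal (Real.exp (-(u * X₀ ω))) ∂P
      = (levyMean ν)⁻¹ * ENNReal.ofReal (laplaceExponent ν u / u) := by
  have := sFinite_of_levyMean_lt_top hν hfin
  have hg : Measurable fun x : ℝ => ENNReal.ofReal (Real.exp (-(u * x))) := by fun_prop
  rw [← lintegral_map (f := fun x => ENNReal.ofReal (Real.exp (-(u * x)))) hg hm,
    hX₀.map_eq hm, lintegral_smul_measure, smul_eq_mul,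
    lintegral_withDensity_eq_lintegral_mul _ (measurable_tail ν) hg]
  congr 1
  simp only [Pi.mul_apply, mul_comm (ν _)]
  rw [lintegral_mul_tail ν hg, div_eq_mul_inv, ENNReal.ofReal_mul' (by positivity),
    ← lintegral_one_sub_exp hν hfin hu.le, ← lintegral_mul_const _ (by fun_prop)]
  refine lintegral_congr_ae (hν.ae_pos.mono fun x hx => ?_)
  simp only
  rw [lintegral_exp_neg_mul_Ioo hu hx.le, div_eq_mul_inv, ENNReal.ofReal_mul' (by positivity)]

end LevyMeasure

/-! ### The occupation measure and the law of the overshoot. -/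

namespace IsRegularLevyPair

variable {Ω : Type*} [MeasurableSpace Ω] {P : Measure Ω}
  {X₀ : Ω → ℝ} {Z : ℝ≥0 → Ω → ℝ} {Φ : ℝ → ℝ} {T : Ω → ℝ≥0} {u : ℝ}

theorem measurable_path (h : IsRegularLevyPair P X₀ Z) :
    Measurable fun p : ℝ × Ω => X₀ p.2 + Z p.1.toNNReal p.2 :=
  (h.measurable_start.comp measurable_snd).add
    (h.measurable_uncurry.comp ((measurable_real_toNNReal.comp measurable_fst).prodMk
      measurable_snd))

variable [IsProbabilityMeasure P]

/-- The Laplace transform of the position at a fixed time after an optional time. -/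
theorem laplace_after (h : IsRegularLevyPair P X₀ Z)
    (hΦ : ∀ t : ℝ≥0, ∫⁻ ω, ENNReal.ofReal (Real.exp (-(u * Z t ω))) ∂P
      = ENNReal.ofReal (Real.exp (-(Φ u * t))))
    (hTm : Measurable T) (hT : ∀ s, MeasurableSet[pastSigma X₀ Z s] {ω | T ω < s}) (t : ℝ≥0) :
    ∫⁻ ω, ENNReal.ofReal (Real.exp (-(u * (X₀ ω + Z (T ω + t) ω)))) ∂P
      = (∫⁻ ω, ENNReal.ofReal (Real.exp (-(u * (X₀ ω + Z (T ω) ω)))) ∂P)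
        * ENNReal.ofReal (Real.exp (-(Φ u * t))) := by
  have hZ : ∀ S : Ω → ℝ≥0, Measurable S → Measurable fun ω => Z (S ω) ω := fun S hS =>
    h.measurable_uncurry.comp (hS.prodMk measurable_id)
  have hX : Measurable fun ω => X₀ ω + Z (T ω) ω := h.measurable_start.add (hZ T hTm)
  have hV : Measurable fun ω (_ : Unit) => Z (T ω + t) ω - Z (T ω) ω :=
    measurable_pi_lambda _ fun _ => (hZ (fun ω => T ω + t) (hTm.add_const _)).sub (hZ T hTm)
  have hq : Measurable fun ω (_ : Unit) => Z t ω := measurable_pi_lambda _ fun _ => h.measurable t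
  have key := h.strong_markov hTm hT fun _ : Unit => t
  have hF : Measurable fun p : ℝ × (Unit → ℝ) =>
    ENNReal.ofReal (Real.exp (-(u * p.1))) * ENNReal.ofReal (Real.exp (-(u * p.2 ()))) := by
    fun_prop
  have e1 := lintegral_map (μ := P) hF (hX.prodMk hV)
  rw [key, lintegral_prod_mul (f := fun x : ℝ => ENNReal.ofReal (Real.exp (-(u * x))))
    (g := fun y : Unit → ℝ => ENNReal.ofReal (Real.exp (-(u * y ()))))
    (by fun_prop) (Measurable.aemeasurable (by fun_prop)), lintegral_map (by fun_prop) hX,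
    lintegral_map (f := fun y : Unit → ℝ => ENNReal.ofReal (Real.exp (-(u * y ()))))
      (by fun_prop) hq, hΦ] at e1
  rw [e1]
  refine lintegral_congr fun ω => ?_
  rw [← ENNReal.ofReal_mul (Real.exp_pos _).le, ← Real.exp_add]
  congr 2
  ring

/-- The Laplace transform of the occupation measure after an optional time. -/
theorem laplace_potential_after (h : IsRegularLevyPair P X₀ Z)
    (hΦ : ∀ t : ℝ≥0, ∫⁻ ω, ENNReal.ofReal (Real.exp (-(u * Z t ω))) ∂P
      = ENNReal.ofReal (Real.exp (-(Φ u * t)))) (hpos : 0 < Φ u)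
    (hTm : Measurable T) (hT : ∀ s, MeasurableSet[pastSigma X₀ Z s] {ω | T ω < s}) :
    ∫⁻ t in Ioi (0 : ℝ), ∫⁻ ω,
        ENNReal.ofReal (Real.exp (-(u * (X₀ ω + Z (T ω + t.toNNReal) ω)))) ∂P
      = (∫⁻ ω, ENNReal.ofReal (Real.exp (-(u * (X₀ ω + Z (T ω) ω)))) ∂P)
        * ENNReal.ofReal (1 / Φ u) := by
  simp_rw [h.laplace_after hΦ hTm hT]
  rw [lintegral_const_mul _ (by fun_prop)]
  congr 1
  have e := lintegral_exp_neg_mul_Ioi hpos 0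
  rw [mul_zero, neg_zero, Real.exp_zero] at e
  rw [← e]
  refine setLIntegral_congr_fun measurableSet_Ioi fun t ht => ?_
  simp only [Real.coe_toNNReal t (le_of_lt ht)]

/-- The expected occupation measure of the process. -/
noncomputable def occupation (P : Measure Ω) (X₀ : Ω → ℝ) (Z : ℝ≥0 → Ω → ℝ) : Measure ℝ :=
  ((volume.restrict (Ioi (0 : ℝ))).prod P).map fun p => X₀ p.2 + Z p.1.toNNReal p.2

theorem lintegral_occupation (h : IsRegularLevyPair P X₀ Z) {g : ℝ → ℝ≥0∞} (hg : Measurable g) :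
    ∫⁻ x, g x ∂occupation P X₀ Z
      = ∫⁻ t in Ioi (0 : ℝ), ∫⁻ ω, g (X₀ ω + Z t.toNNReal ω) ∂P := by
  rw [occupation, lintegral_map hg h.measurable_path,
    lintegral_prod (fun p : ℝ × Ω => g (X₀ p.2 + Z p.1.toNNReal p.2)) (hg.comp h.measurable_path).aemeasurable]

/-- If the law of `X₀` has Laplace transform `c Φ(u) / u`, then the expected occupation measure is
a multiple of Lebesgue measure. -/
theorem occupation_eq (h : IsRegularLevyPair P X₀ Z)
    (hΦ : ∀ u, 0 < u → ∀ t : ℝ≥0, ∫⁻ ω, ENNReal.ofReal (Real.exp (-(u * Z t ω))) ∂P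
      = ENNReal.ofReal (Real.exp (-(Φ u * t)))) (hpos : ∀ u, 0 < u → 0 < Φ u)
    {c : ℝ≥0∞} (hc : c ≠ ∞)
    (hX₀ : ∀ u, 0 < u → ∫⁻ ω, ENNReal.ofReal (Real.exp (-(u * X₀ ω))) ∂P
      = c * ENNReal.ofReal (Φ u / u)) :
    occupation P X₀ Z = c • volume.restrict (Ioi 0) := by
  have lap1 : ∀ u, 0 < u → ∫⁻ x, ENNReal.ofReal (Real.exp (-(u * x))) ∂occupation P X₀ Z
      = c * ENNReal.ofReal (1 / u) := by
    intro u hu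
    rw [h.lintegral_occupation (by fun_prop)]
    -- The constant time 0 yields the occupation measure of the whole process.
    have key := h.laplace_potential_after (T := fun _ => 0) (hΦ u hu) (hpos u hu)
      measurable_const (fun s => @MeasurableSet.const _ (pastSigma X₀ Z s) _)
    simp only [zero_add, h.zero, add_zero] at key
    rw [key, hX₀ u hu, mul_assoc, ← ENNReal.ofReal_mul (div_nonneg (hpos u hu).le hu.le)]
    congr 2
    have := (hpos u hu).ne'
    field_simp
  have lap2 : ∀ u, 0 < u → ∫⁻ x, ENNReal.ofReal (Real.exp (-(u * x)))
      ∂(c • volume.restrict (Ioi (0 : ℝ))) = c * ENNReal.ofReal (1 / u) := by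
    intro u hu
    rw [lintegral_smul_measure, lintegral_exp_neg_mul_Ioi hu]
    simp
  refine ext_of_laplace_eq ?_ ?_ ?_ fun u hu => by rw [lap1 u hu, lap2 u hu]
  · rw [occupation]
    refine (ae_map_iff h.measurable_path.aemeasurable measurableSet_Ici).2 (ae_of_all _ fun p => ?_)
    have := h.mono p.2 (zero_le (a := p.1.toNNReal))
    simp only [h.zero] at this
    exact add_nonneg (h.pos _).le this
  · refine Measure.ae_smul_measure ?_ c
    exact (ae_restrict_mem measurableSet_Ioi).mono fun x hx => le_of_lt hx
  · have := lap1 1 one_pos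
    simp only [one_mul] at this
    rw [this]
    exact ENNReal.mul_ne_top hc ENNReal.ofReal_ne_top

/-- The occupation of `(a, ∞)` is the occupation after the passage above `a`. -/
theorem lintegral_occupation_Ioi (h : IsRegularLevyPair P X₀ Z) (a : ℝ≥0) {g : ℝ → ℝ≥0∞}
    (hg : Measurable g) :
    ∫⁻ x in Ioi (a : ℝ), g x ∂occupation P X₀ Z
      = ∫⁻ t in Ioi (0 : ℝ), ∫⁻ ω, g (X₀ ω
          + Z (firstPassage (fun t ω => X₀ ω + Z t ω) a ω + t.toNNReal) ω) ∂P := by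
  set T := firstPassage (fun t ω => X₀ ω + Z t ω) a with hTdef
  have hTm : Measurable T := h.measurable_firstPassage a
  have hg' : Measurable ((Ioi (a : ℝ)).indicator g) := hg.indicator measurableSet_Ioi
  have hshift : Measurable fun p : ℝ × Ω => X₀ p.2 + Z (T p.2 + p.1.toNNReal) p.2 :=
    (h.measurable_start.comp measurable_snd).add (h.measurable_uncurry.comp
      (((hTm.comp measurable_snd).add (measurable_real_toNNReal.comp measurable_fst)).prodMk
        measurable_snd))
  rw [← lintegral_indicator measurableSet_Ioi, h.lintegral_occupation hg',
    lintegral_lintegral_swap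
      (f := fun (t : ℝ) ω => (Ioi (a : ℝ)).indicator g (X₀ ω + Z t.toNNReal ω)) (hg'.comp h.measurable_path).aemeasurable,
    lintegral_lintegral_swap
      (f := fun (t : ℝ) ω => g (X₀ ω + Z (T ω + t.toNNReal) ω)) (hg.comp hshift).aemeasurable]
  refine lintegral_congr fun ω => ?_
  have e1 : ∫⁻ t in Ioi (0 : ℝ), (Ioi (a : ℝ)).indicator g (X₀ ω + Z t.toNNReal ω)
      = ∫⁻ t, (Ioi (T ω : ℝ)).indicator (fun t => g (X₀ ω + Z t.toNNReal ω)) t := by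
    rw [← lintegral_indicator measurableSet_Ioi]
    refine lintegral_congr_ae ?_
    -- At T itself the path may equal a, so membership in (a,∞) is undecided there; one instant is
    -- Lebesgue-null.
    have hne : ∀ᵐ t : ℝ, t ≠ T ω := by simp [ae_iff]
    filter_upwards [hne] with t ht
    rcases lt_or_gt_of_ne ht with hlt | hgt
    · rw [indicator_of_notMem (s := Ioi (T ω : ℝ)) (by simpa using hlt.le)]
      by_cases h0 : 0 < t
      · rw [indicator_of_mem (mem_Ioi.2 h0), indicator_of_notMem]
        intro hmem
        have hle : T ω ≤ t.toNNReal :=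
          firstPassage_le (X := fun t ω => X₀ ω + Z t ω) hmem
        have : (T ω : ℝ) ≤ t := (Real.le_toNNReal_iff_coe_le h0.le).1 hle
        linarith
      · rw [indicator_of_notMem (by simpa using h0)]
    · have h0 : 0 < t := lt_of_le_of_lt (T ω).2 hgt
      rw [indicator_of_mem (mem_Ioi.2 h0), indicator_of_mem (mem_Ioi.2 hgt), indicator_of_mem]
      exact lt_of_firstPassage_lt (X := fun t ω => X₀ ω + Z t ω) (h.monotone_path ω)
        (h.exists_lt ω a) (Real.lt_toNNReal_iff_coe_lt.2 hgt)
  rw [e1, ← lintegral_add_left_eq_self _ (T ω : ℝ), ← lintegral_indicator measurableSet_Ioi]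
  refine lintegral_congr fun t => ?_
  by_cases h0 : 0 < t
  · rw [indicator_of_mem (by simpa using h0), indicator_of_mem (mem_Ioi.2 h0),
      Real.toNNReal_add (T ω).coe_nonneg h0.le, Real.toNNReal_coe]
  · rw [indicator_of_notMem (by simpa using h0), indicator_of_notMem (by simpa using h0)]

/-- If the law of `X₀` has Laplace transform `c Φ(u) / u`, then the overshoot over every level
is distributed as `X₀`. -/
theorem map_overshoot (h : IsRegularLevyPair P X₀ Z)
    (hΦ : ∀ u, 0 < u → ∀ t : ℝ≥0, ∫⁻ ω, ENNReal.ofReal (Real.exp (-(u * Z t ω))) ∂P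
      = ENNReal.ofReal (Real.exp (-(Φ u * t)))) (hpos : ∀ u, 0 < u → 0 < Φ u)
    {c : ℝ≥0∞} (hc : c ≠ ∞)
    (hX₀ : ∀ u, 0 < u → ∫⁻ ω, ENNReal.ofReal (Real.exp (-(u * X₀ ω))) ∂P
      = c * ENNReal.ofReal (Φ u / u)) (a : ℝ≥0) :
    P.map (overshoot (fun t ω => X₀ ω + Z t ω) a) = P.map X₀ := by
  set T := firstPassage (fun t ω => X₀ ω + Z t ω) a with hTdef
  have hTm : Measurable T := h.measurable_firstPassage a
  have hX : Measurable fun ω => X₀ ω + Z (T ω) ω :=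
    h.measurable_start.add (h.measurable_uncurry.comp (hTm.prodMk measurable_id))
  have hΓ : Measurable (overshoot (fun t ω => X₀ ω + Z t ω) a) := hX.sub_const _
  have lap : ∀ u, 0 < u →
      ∫⁻ ω, ENNReal.ofReal (Real.exp (-(u * overshoot (fun t ω => X₀ ω + Z t ω) a ω))) ∂P
        = c * ENNReal.ofReal (Φ u / u) := by
    intro u hu
    have hΦu := hpos u hu
    have key := h.lintegral_occupation_Ioi a
      (g := fun x => ENNReal.ofReal (Real.exp (-(u * x)))) (by fun_prop)
    -- Both evaluations of the transform over (a,∞) meet here: the Lebesgue form on the left, the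
    -- strong Markov form on the right.
    rw [h.laplace_potential_after (hΦ u hu) hΦu hTm (h.measurableSet_firstPassage_lt a),
      h.occupation_eq hΦ hpos hc hX₀, Measure.restrict_smul, lintegral_smul_measure,
      Measure.restrict_restrict measurableSet_Ioi, inter_eq_self_of_subset_left
        (Ioi_subset_Ioi a.coe_nonneg), lintegral_exp_neg_mul_Ioi hu, smul_eq_mul] at key
    have e : ∀ ω, ENNReal.ofReal
        (Real.exp (-(u * overshoot (fun t ω => X₀ ω + Z t ω) a ω)))
        = ENNReal.ofReal (Real.exp (-(u * (X₀ ω + Z (T ω) ω))))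
          * (ENNReal.ofReal (1 / Φ u) * ENNReal.ofReal (Φ u * Real.exp (u * a))) := by
      intro ω
      rw [← ENNReal.ofReal_mul (by positivity), ← ENNReal.ofReal_mul (Real.exp_pos _).le,
        ← mul_assoc (1 / Φ u), one_div, inv_mul_cancel₀ hΦu.ne', one_mul, ← Real.exp_add, overshoot]
      congr 2
      ring
    simp_rw [e]
    rw [lintegral_mul_const _ (by fun_prop), ← mul_assoc, ← key, mul_assoc,
      ← ENNReal.ofReal_mul (by positivity)]
    congr 2
    rw [Real.exp_neg]
    have := Real.exp_pos (u * a)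
    field_simp
  refine ext_of_laplace_eq ?_ ?_ ?_ fun u hu => ?_
  · refine (ae_map_iff hΓ.aemeasurable measurableSet_Ici).2 (ae_of_all _ fun ω => ?_)
    exact sub_nonneg.2 (le_at_firstPassage (X := fun t ω => X₀ ω + Z t ω) (h.monotone_path ω)
      ((h.rightCont ω _).const_add _) (h.exists_lt ω a))
  · exact (ae_map_iff h.measurable_start.aemeasurable measurableSet_Ici).2
      (ae_of_all _ fun ω => (h.pos ω).le)
  · have := lap 1 one_pos
    simp only [one_mul] at this
    rw [lintegral_map (by fun_prop) hΓ, this]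
    exact ENNReal.mul_ne_top hc ENNReal.ofReal_ne_top
  · rw [lintegral_map (by fun_prop) hΓ, lintegral_map (by fun_prop) h.measurable_start, lap u hu,
      hX₀ u hu]

end IsRegularLevyPair

/-! ### Stationary increments of the passage times, and regular versions. -/

section
variable {Ω : Type*} [MeasurableSpace Ω] {P : Measure Ω} {ν : Measure ℝ}
  {X₀ : Ω → ℝ} {Z : ℝ≥0 → Ω → ℝ}

theorem IsDriftlessSubordinator.ae_nonneg (hZ : IsDriftlessSubordinator Z ν P) :
    ∀ᵐ ω ∂P, ∀ t, 0 ≤ Z t ω := by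
  filter_upwards [hZ.start_zero, hZ.monotone_paths] with ω h0 hmono t
  rw [← h0]
  exact hmono zero_le

variable [IsProbabilityMeasure P]

/-- If the overshoot over the level `a` is distributed as `X₀`, then the passage times above `a`,
counted from the passage above `a`, are distributed as the passage times above `0`. -/
theorem IsRegularLevyPair.identDistrib_firstPassage_add_sub (h : IsRegularLevyPair P X₀ Z) (a : ℝ≥0)
    (hov : P.map (overshoot (fun t ω => X₀ ω + Z t ω) a) = P.map X₀) (n : ℕ) (x : Fin n → ℝ≥0) :
    IdentDistrib
      (fun ω i => (firstPassage (fun t ω => X₀ ω + Z t ω) (a + x i) ω : ℝ)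
        - firstPassage (fun t ω => X₀ ω + Z t ω) a ω)
      (fun ω i => (firstPassage (fun t ω => X₀ ω + Z t ω) (x i) ω : ℝ)
        - firstPassage (fun t ω => X₀ ω + Z t ω) 0 ω) P P := by
  set X : ℝ≥0 → Ω → ℝ := fun t ω => X₀ ω + Z t ω with hXdef
  set T := firstPassage X a with hTdef
  let V : Ω → ℕ → ℝ := fun ω j => Z (T ω + denseSeq ℝ≥0 j) ω - Z (T ω) ω
  let W : Ω → ℕ → ℝ := fun ω j => Z (denseSeq ℝ≥0 j) ω
  have hTm : Measurable T := h.measurable_firstPassage a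
  have hZ : ∀ S : Ω → ℝ≥0, Measurable S → Measurable fun ω => Z (S ω) ω := fun S hS =>
    h.measurable_uncurry.comp (hS.prodMk measurable_id)
  have hX : Measurable fun ω => X₀ ω + Z (T ω) ω := h.measurable_start.add (hZ T hTm)
  have hΓ : Measurable (overshoot X a) := hX.sub_const _
  have hV : Measurable V := measurable_pi_lambda _ fun j =>
    (hZ (fun ω => T ω + denseSeq ℝ≥0 j) (hTm.add_const _)).sub (hZ T hTm)
  have hW : Measurable W := measurable_pi_lambda _ fun j => h.measurable _
  have := Measure.isProbabilityMeasure_map (μ := P) hX.aemeasurable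
  have := Measure.isProbabilityMeasure_map (μ := P) hW.aemeasurable
  have law1 : P.map (fun ω => (overshoot X a ω, V ω)) = (P.map X₀).prod (P.map W) := by
    have key := congrArg (Measure.map (Prod.map (fun y : ℝ => y - a) (id : (ℕ → ℝ) → ℕ → ℝ)))
      (h.strong_markov hTm (h.measurableSet_firstPassage_lt a) (denseSeq ℝ≥0))
    rw [← Measure.map_prod_map _ _ (by fun_prop) measurable_id, Measure.map_id,
      Measure.map_map (by fun_prop) hX, Measure.map_map (by fun_prop) (hX.prodMk hV)] at key
    rw [← hov]
    exact key
  have law2 : P.map (fun ω => (X₀ ω, W ω)) = (P.map X₀).prod (P.map W) := by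
    rw [← indepFun_iff_map_prod_eq_prod_map_map h.measurable_start.aemeasurable hW.aemeasurable]
    have hres : Measurable fun (z : ℝ≥0 → ℝ) j => z (denseSeq ℝ≥0 j) := by fun_prop
    exact h.indep_start.comp measurable_id hres
  have hid : IdentDistrib (fun ω => (overshoot X a ω, V ω)) (fun ω => (X₀ ω, W ω)) P P :=
    ⟨(hΓ.prodMk hV).aemeasurable, (h.measurable_start.prodMk hW).aemeasurable,
      law1.trans law2.symm⟩
  -- One measurable functional of the starting value and of countably many path values gives both
  -- families of passage times, so equality of these joint laws suffices.
  have hF : Measurable fun (p : ℝ × (ℕ → ℝ)) (i : Fin n) =>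
      passageFunctional (x i) fun j => p.1 + p.2 j :=
    measurable_pi_lambda _ fun i => (measurable_passageFunctional (x i)).comp (by fun_prop)
  convert! hid.comp hF using 1
  · ext ω i
    simp only [Function.comp_apply]
    have hmono : Monotone fun t => X (T ω + t) ω - a := fun s t hst =>
      sub_le_sub_right (h.monotone_path ω (add_le_add le_rfl hst)) _
    have hunb : ∃ t, (x i : ℝ) < X (T ω + t) ω - a := by
      obtain ⟨t, ht⟩ := h.exists_lt ω (x i + a)
      exact ⟨t, lt_sub_iff_add_lt.2 (ht.trans_le (h.monotone_path ω le_add_self))⟩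
    rw [firstPassage_add (X := X) (h.monotone_path ω) (h.exists_lt ω _), NNReal.coe_add,
      add_sub_cancel_left,
      firstPassage_eq_passageFunctional (X := fun t ω => X (firstPassage X a ω + t) ω - a)
        hmono hunb]
    congr 1
    ext j
    simp only [overshoot, V, hXdef]
    ring
  · ext ω i
    have h0 : 0 < X 0 ω := by simpa [hXdef, h.zero] using h.pos ω
    simp only [Function.comp_apply]
    rw [firstPassage_zero h0, NNReal.coe_zero, sub_zero,
      firstPassage_eq_passageFunctional (h.monotone_path ω) (h.exists_lt ω _)]

theorem IsDriftlessSubordinator.lintegral_exp (hZ : IsDriftlessSubordinator Z ν P) (t : ℝ≥0)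
    {u : ℝ} (hu : 0 ≤ u) :
    ∫⁻ ω, ENNReal.ofReal (Real.exp (-(u * Z t ω))) ∂P
      = ENNReal.ofReal (Real.exp (-(laplaceExponent ν u * t))) := by
  have hm := hZ.measurable t
  rw [mul_comm (laplaceExponent ν u), ← hZ.laplace t u hu,
    ofReal_integral_eq_lintegral_ofReal ?_ (ae_of_all _ fun ω => (Real.exp_pos _).le)]
  refine Integrable.of_bound (by fun_prop) 1 (hZ.ae_nonneg.mono fun ω hω => ?_)
  have := mul_nonneg hu (hω t)
  simpa using this

/-- If Z stayed below N with positive probability p, then E e^{-Z_n} ≥ e^{-N} p for all n, whereas E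
e^{-Z_n} = e^{-nΦ(1)} tends to 0. -/
theorem IsDriftlessSubordinator.ae_unbounded (hZ : IsDriftlessSubordinator Z ν P)
    (hΦ : 0 < laplaceExponent ν 1) : ∀ᵐ ω ∂P, ∀ x, ∃ t, x < Z t ω := by
  have bounded_null : ∀ N : ℕ, P {ω | ∀ n : ℕ, Z n ω ≤ N} = 0 := by
    intro N
    have bound : ∀ n : ℕ, ENNReal.ofReal (Real.exp (-N)) * P {ω | ∀ n : ℕ, Z n ω ≤ N}
        ≤ ENNReal.ofReal (Real.exp (-(laplaceExponent ν 1 * n))) := by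
      intro n
      have hm := hZ.measurable n
      have e := hZ.lintegral_exp n zero_le_one
      simp only [one_mul, NNReal.coe_natCast] at e
      rw [← e]
      refine le_trans ?_ (mul_meas_ge_le_lintegral₀ (by fun_prop) (ENNReal.ofReal (Real.exp (-N))))
      gcongr with ω
      exact fun hω => by gcongr; exact hω n
    have lim : Tendsto (fun n : ℕ => ENNReal.ofReal (Real.exp (-(laplaceExponent ν 1 * n))))
        atTop (𝓝 0) := by
      rw [← ENNReal.ofReal_zero]
      refine ENNReal.tendsto_ofReal (Real.tendsto_exp_neg_atTop_nhds_zero.comp ?_)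
      exact tendsto_natCast_atTop_atTop.const_mul_atTop hΦ
    have := le_antisymm (ge_of_tendsto lim (Eventually.of_forall bound)) zero_le
    exact (mul_eq_zero.1 this).resolve_left (by simp [Real.exp_pos])
  have := ae_all_iff.2 fun N : ℕ => measure_eq_zero_iff_ae_notMem.1 (bounded_null N)
  filter_upwards [this] with ω hω x
  obtain ⟨N, hN⟩ := exists_nat_gt x
  have := hω N
  simp only [not_forall, not_le] at this
  obtain ⟨n, hn⟩ := this
  exact ⟨n, hN.trans hn⟩

/-- A driftless subordinator and an independent positive starting point coincide, off a null set,
with a pair all of whose paths are regular. -/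
theorem IsDriftlessSubordinator.exists_regular (hZ : IsDriftlessSubordinator Z ν P)
    (hΦ : 0 < laplaceExponent ν 1) (hm : Measurable X₀) (hpos : ∀ᵐ ω ∂P, 0 < X₀ ω)
    (hind : IndepFun X₀ (fun ω t => Z t ω) P) :
    ∃ X₀' Z', IsRegularLevyPair P X₀' Z' ∧
      ∀ᵐ ω ∂P, X₀' ω = X₀ ω ∧ ∀ t, Z' t ω = Z t ω := by
  classical
  have good : ∀ᵐ ω ∂P, 0 < X₀ ω ∧ Z 0 ω = 0 ∧ (Monotone fun t => Z t ω) ∧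
      (∀ t, ContinuousWithinAt (fun s => Z s ω) (Ici t) t) ∧ ∀ x, ∃ t, x < Z t ω := by
    filter_upwards [hpos, hZ.start_zero, hZ.monotone_paths, hZ.rightContinuous_paths,
      hZ.ae_unbounded hΦ] with ω h1 h2 h3 h4 h5 using ⟨h1, h2, h3, h4, h5⟩
  obtain ⟨N, hsub, hN, hN0⟩ := exists_measurable_superset_of_null (ae_iff.1 good)
  have hgood : ∀ ω, ω ∉ N → 0 < X₀ ω ∧ Z 0 ω = 0 ∧ (Monotone fun t => Z t ω) ∧
      (∀ t, ContinuousWithinAt (fun s => Z s ω) (Ici t) t) ∧ ∀ x, ∃ t, x < Z t ω := by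
    intro ω hω
    by_contra hc
    exact hω (hsub hc)
  -- On the null set the process is replaced by the deterministic path 1 + t, which has every
  -- required regularity.
  let X₀' : Ω → ℝ := fun ω => if ω ∈ N then 1 else X₀ ω
  let Z' : ℝ≥0 → Ω → ℝ := fun t ω => if ω ∈ N then t else Z t ω
  have hae : ∀ᵐ ω ∂P, X₀' ω = X₀ ω ∧ ∀ t, Z' t ω = Z t ω := by
    filter_upwards [measure_eq_zero_iff_ae_notMem.1 hN0] with ω hω
    simp [X₀', Z', hω]
  have haeX : X₀ =ᵐ[P] X₀' := hae.mono fun ω hω => hω.1.symm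
  have haeZ : ∀ t, Z t =ᵐ[P] Z' t := fun t => hae.mono fun ω hω => (hω.2 t).symm
  have haeincr : ∀ s t, (fun ω => Z t ω - Z s ω) =ᵐ[P] fun ω => Z' t ω - Z' s ω := fun s t =>
    (haeZ t).sub (haeZ s)
  have hZ'm : ∀ t, Measurable (Z' t) := fun t => Measurable.ite hN measurable_const (hZ.measurable t)
  refine ⟨X₀', Z', ⟨Measurable.ite hN measurable_const hm, hZ'm, ?_, ?_, ?_, ?_, ?_, ?_, ?_, ?_⟩,
    hae⟩
  · intro ω
    by_cases hω : ω ∈ N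
    · simp [Z', hω]
    · simp [Z', hω, (hgood ω hω).2.1]
  · intro ω
    by_cases hω : ω ∈ N
    · simpa [Z', hω] using NNReal.coe_mono
    · simpa [Z', hω] using (hgood ω hω).2.2.1
  · intro ω t
    by_cases hω : ω ∈ N
    · simpa [Z', hω] using NNReal.continuous_coe.continuousWithinAt
    · simpa [Z', hω] using (hgood ω hω).2.2.2.1 t
  · intro ω
    by_cases hω : ω ∈ N
    · simp [X₀', hω]
    · simpa [X₀', hω] using (hgood ω hω).1
  · intro ω x
    by_cases hω : ω ∈ N
    · obtain ⟨n, hn⟩ := exists_nat_gt x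
      exact ⟨n, by simpa [Z', hω] using hn⟩
    · simpa [Z', hω] using (hgood ω hω).2.2.2.2 x
  · exact fun n t ht => (hZ.indep_increments n t ht).congr fun i => haeincr _ _
  · intro s t
    exact ((IdentDistrib.of_ae_eq ((hZ'm _).sub (hZ'm _)).aemeasurable (haeincr _ _).symm).trans
      (hZ.stationary_increments s t)).trans
      (IdentDistrib.of_ae_eq (hZ.measurable t).aemeasurable (haeZ t))
  · exact (hind.process_congr_right haeZ).congr haeX EventuallyEq.rfl

end

theorem lemma1 {Ω : Type*} [MeasurableSpace Ω] (P : Measure Ω) [IsProbabilityMeasure P]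
    (ν : Measure ℝ) (hν : IsSubordinatorLevyMeasure ν)
    (hμ_pos : 0 < levyMean ν) (hμ_fin : levyMean ν < ∞)
    (Xtilde : ℝ≥0 → Ω → ℝ) (hXtilde : IsDriftlessSubordinator Xtilde ν P)
    (X₀ : Ω → ℝ) (hX₀_meas : Measurable X₀) (hX₀_law : HasIntegratedTailLaw X₀ ν P)
    (hX₀_indep : IndepFun X₀ (fun ω t => Xtilde t ω) P)
    (X : ℝ≥0 → Ω → ℝ) (hX : ∀ t ω, X t ω = X₀ ω + Xtilde t ω) :
    (∀ᵐ ω ∂P, ∀ x : ℝ≥0, ∃ t : ℝ≥0, (x : ℝ) < X t ω) ∧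
    (∀ x : ℝ≥0, IdentDistrib (overshoot X x) X₀ P P) ∧
    HasStationaryIncrements (fun x ω => (firstPassage X x ω : ℝ)) P := by
  have hΦpos : ∀ u, 0 < u → 0 < laplaceExponent ν u := fun u hu =>
    laplaceExponent_pos hν hμ_pos hμ_fin hu
  obtain ⟨X₀', Z, h, hae⟩ := hXtilde.exists_regular (hΦpos 1 one_pos) hX₀_meas hX₀_law.ae_pos
    hX₀_indep
  have haeX : ∀ᵐ ω ∂P, ∀ t, X₀' ω + Z t ω = X t ω := hae.mono fun ω hω t => by
    rw [hX, hω.1, hω.2]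
  have haeT : ∀ᵐ ω ∂P, ∀ a, firstPassage (fun t ω => X₀' ω + Z t ω) a ω = firstPassage X a ω :=
    haeX.mono fun ω hω a => by simp only [firstPassage, hω]
  have hlapZ : ∀ u, 0 < u → ∀ t : ℝ≥0, ∫⁻ ω, ENNReal.ofReal (Real.exp (-(u * Z t ω))) ∂P
      = ENNReal.ofReal (Real.exp (-(laplaceExponent ν u * t))) := fun u hu t => by
    rw [← hXtilde.lintegral_exp t hu.le]
    exact lintegral_congr_ae (hae.mono fun ω hω => by simp only [hω.2])
  have hlapX₀ : ∀ u, 0 < u → ∫⁻ ω, ENNReal.ofReal (Real.exp (-(u * X₀' ω))) ∂P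
      = (levyMean ν)⁻¹ * ENNReal.ofReal (laplaceExponent ν u / u) := fun u hu => by
    rw [← hX₀_law.laplace hX₀_meas hν hμ_fin hu]
    exact lintegral_congr_ae (hae.mono fun ω hω => by simp only [hω.1])
  have hov := h.map_overshoot hlapZ hΦpos (ENNReal.inv_ne_top.2 hμ_pos.ne') hlapX₀
  have hTm := h.measurable_firstPassage
  have hΓm : ∀ a, Measurable (overshoot (fun t ω => X₀' ω + Z t ω) a) := fun a =>
    (h.measurable_start.add (h.measurable_uncurry.comp ((hTm a).prodMk measurable_id))).sub_const _
  refine ⟨haeX.mono fun ω hω x => ?_, fun x => ?_, fun a n x => ?_⟩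
  · simpa only [hω] using h.exists_lt ω x
  · have e1 : overshoot (fun t ω => X₀' ω + Z t ω) x =ᵐ[P] overshoot X x := by
      filter_upwards [haeX, haeT] with ω h1 h2
      simp only [overshoot, h2, h1]
    have e2 : X₀' =ᵐ[P] X₀ := hae.mono fun ω hω => hω.1
    exact ((IdentDistrib.of_ae_eq (hΓm x).aemeasurable e1).symm.trans
      ⟨(hΓm x).aemeasurable, h.measurable_start.aemeasurable, hov x⟩).trans
      (IdentDistrib.of_ae_eq h.measurable_start.aemeasurable e2)
  · have key := h.identDistrib_firstPassage_add_sub a (hov a) n x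
    have e1 := haeT.mono fun ω hω => show
      (fun i => (firstPassage (fun t ω => X₀' ω + Z t ω) (a + x i) ω : ℝ)
        - firstPassage (fun t ω => X₀' ω + Z t ω) a ω)
      = fun i => (firstPassage X (a + x i) ω : ℝ) - firstPassage X a ω by simp only [hω]
    have e2 := haeT.mono fun ω hω => show
      (fun i => (firstPassage (fun t ω => X₀' ω + Z t ω) (x i) ω : ℝ)
        - firstPassage (fun t ω => X₀' ω + Z t ω) 0 ω)
      = fun i => (firstPassage X (x i) ω : ℝ) - firstPassage X 0 ω by simp only [hω]
    exact ((IdentDistrib.of_ae_eq key.aemeasurable_fst e1).symm.trans key).trans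
      (IdentDistrib.of_ae_eq key.aemeasurable_snd e2)
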